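/- Let $G$ be a weighted multigraph with vertex set $\{1,\dots,n\}$ and finitely many edges (parallel edges and loops are allowed), each edge $e$ having a strictly positive weight $\varepsilon(e)$, and let $v$ be the number of connected components of $G$. Let $L=(\ell_{ij})$ be the Laplacian matrix of $G$: for $i\neq j$, $-\ell_{ij}$ is the total weight of the edges joining $i$ and $j$, and $\ell_{ii}=-\sum_{j\neq i}\ell_{ij}$. A spanning rooted forest of $G$ is an acyclic subgraph of $G$ with the same vertex set as $G$, together with one marked vertex (a root) in each of its components. The weight of a forest is the product of the weights of its edges (equal to $1$ if there are none), and the weight $\varepsilon(\mathcal{G})$ of a set $\mathcal{G}$ of forests is the sum of the weights of its elements (equal to $0$ if $\mathcal{G}$ is empty). Let $\mathcal{F}_k$ be the set of spanning rooted forests of $G$ with exactly $k$ edges, and let $\mathcal{F}^{ij}_k\subseteq\mathcal{F}_k$ be the set of those in which $j$ belongs to a tree rooted at $i$. Then for every real $\tau\ge 0$ the matrix $I+\tau L$ is invertible, the sum $\sum_{k=0}^{n-v}\tau^k\,\varepsilon(\mathcal{F}_k)$ is nonzero, and for all $i,j=1,\dots,n$ $$\bigl((I+\tau L)^{-1}\bigr)_{ij}=\frac{\sum_{k=0}^{n-v}\tau^k\,\varepsilon(\mathcal{F}^{ij}_k)}{\sum_{k=0}^{n-v}\tau^k\,\varepsilon(\mathcal{F}_k)}.$$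 -/

import Mathlib

namespace MatrixForest

variable {V E : Type*}

/-- There is a path (possibly of length `0`) from `x` to `y` in the multigraph `G`. -/
def Reachable (G : Graph V E) (x y : V) : Prop :=
  Relation.ReflTransGen G.Adj x y

/-- The connected components of `G`, as sets of vertices. -/
def components (G : Graph V E) : Set (Set V) :=
  {C | ∃ x ∈ G.vertexSet, C = {y | Reachable G x y}}

/-- The number of connected components of `G`. -/
noncomputable def numComponents (G : Graph V E) : ℕ :=
  (components G).ncard

/-- `G` contains a cycle: for some `m`, there are `m + 1` distinct vertices and `m + 1` distinct
edges such that the `i`-th edge links the `i`-th vertex to the next one, cyclically (addition in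
`Fin (m + 1)` is modulo `m + 1`). A loop is a cycle (`m = 0`), and so is a pair of parallel
edges (`m = 1`). -/
def HasCycle (G : Graph V E) : Prop :=
  ∃ (m : ℕ) (v : Fin (m + 1) → V) (e : Fin (m + 1) → E),
    Function.Injective v ∧ Function.Injective e ∧ ∀ i, G.IsLink (e i) (v i) (v (i + 1))

/-- `(H, R)` is a spanning rooted forest of `G`: `H` is an acyclic subgraph of `G` with the same
vertex set, and the set `R` of roots has exactly one vertex in each component of `H`. -/
structure IsSpanningRootedForest (G : Graph V E) (F : Graph V E × Set V) : Prop where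
  spanning : F.1.IsSpanningSubgraph G
  acyclic : ¬ HasCycle F.1
  roots_subset : F.2 ⊆ F.1.vertexSet
  existsUnique_root : ∀ C ∈ components F.1, ∃! r, r ∈ F.2 ∧ r ∈ C

/-- The set `𝓕ₖ` of the spanning rooted forests of `G` that have exactly `k` edges. -/
def forests (G : Graph V E) (k : ℕ) : Set (Graph V E × Set V) :=
  {F | IsSpanningRootedForest G F ∧ F.1.edgeSet.ncard = k}

/-- The set `𝓕ₖⁱʲ` of those forests in `𝓕ₖ` in which `j` belongs to a tree rooted at `i`. -/
def forestsRootedAt (G : Graph V E) (i j : V) (k : ℕ) : Set (Graph V E × Set V) :=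
  {F | F ∈ forests G k ∧ i ∈ F.2 ∧ Reachable F.1 i j}

/-- The weight of a subgraph: the product of the weights of its edges. -/
noncomputable def subgraphWeight (ε : E → ℝ) (H : Graph V E) : ℝ :=
  ∏ᶠ e ∈ H.edgeSet, ε e

/-- The weight of a set of rooted subgraphs: the sum of their weights. -/
noncomputable def setWeight (ε : E → ℝ) (𝒢 : Set (Graph V E × Set V)) : ℝ :=
  ∑ᶠ F ∈ 𝒢, subgraphWeight ε F.1

/-- The total weight of the edges that link `i` and `j`. -/
noncomputable def totalWeight (G : Graph V E) (ε : E → ℝ) (i j : V) : ℝ :=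
  ∑ᶠ e ∈ {e | G.IsLink e i j}, ε e

/-- The weighted Laplacian matrix of `G`: the entry at `(i, j)` with `i ≠ j` is minus the total
weight of the edges that link `i` and `j`, and the rows sum to zero. -/
noncomputable def laplacian [Fintype V] [DecidableEq V] (G : Graph V E) (ε : E → ℝ) :
    Matrix V V ℝ :=
  Matrix.of fun i j =>
    if i = j then ∑ k ∈ Finset.univ.erase i, totalWeight G ε i k else -totalWeight G ε i j

end MatrixForest

/-!
A rooted forest is encoded by its parent function `p : V → Option G.edgeSet`, which sends each
vertex to the first edge on its path to the root, and each root to `none`. This identifies the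
spanning rooted forests of `G` with the parent functions along which every vertex reaches a root
(`parentForest_injOn`, `IsSpanningRootedForest.exists_parentForest_eq`), and `i` is the root of the
tree of `j` if and only if `j` leads to `i` (`Acyclic.isRootOf_iff`). Hence the sums
`∑ τ ^ k ε(𝓕ₖ)` and `∑ τ ^ k ε(𝓕ₖⁱʲ)` are weighted sums `Z` and `Q i j` over acyclic parent
functions (`sum_pow_mul_setWeight`); the range of summation suffices because every component of
`G` contains a root.

For fixed `i` these sums satisfy the linear system
`Q i j + ∑ τ ε(e) (Q i j - Q i (e · j)) = δ i j * Z`, where `e · j` is the end of the edge `e` other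
than `j` (`acyclicSum_isRootOf_mul_sum`). To see this, consider pairs `(p, x)` of an acyclic
parent function and a further arc `x` out of `j` (possibly empty), and exchange `x` with the arc of
`p` at `j`. If the result is acyclic, then the new spare arc leads to the old root of `j`.
Otherwise `x` closes a cycle, so `j` and the head of `x` have the same root, and the pair is left
alone. In both cases pairs in which `j` has root `i` correspond to pairs in which the spare arc
leads to `i`, with the same weight.

The system says that `(1 + τ L) * Qᵀ = Z • 1` (`one_add_smul_laplacian_mul`). Since `Z > 0` and `L`
is symmetric, the inverse of `1 + τ L` is `Z⁻¹ • Q`.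
-/

namespace MatrixForest

/-! ### Parent functions -/

section ParentFunction

variable {V D : Type*} {t : V → D → V} {p : V → Option D} {v w r r' : V} {n m : ℕ}

/-- `LeadsTo t p v n r`: following the parent function `p` from `v`, one reaches the root `r` in
exactly `n` steps. Here `p v` is the label of the arc that leaves `v` (`none` if `v` is a root),
and `t v d` is the head of the arc with label `d` that leaves `v`. -/
inductive LeadsTo (t : V → D → V) (p : V → Option D) : V → ℕ → V → Prop
  | root {v : V} : p v = none → LeadsTo t p v 0 v
  | step {v : V} {d : D} {n : ℕ} {r : V} :
      p v = some d → LeadsTo t p (t v d) n r → LeadsTo t p v (n + 1) r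

/-- `r` is the root reached from `v` along the parent function `p`. -/
def IsRootOf (t : V → D → V) (p : V → Option D) (r v : V) : Prop :=
  ∃ n, LeadsTo t p v n r

/-- A parent function is acyclic if a root is reached from every vertex. -/
def Acyclic (t : V → D → V) (p : V → Option D) : Prop :=
  ∀ v, ∃ r, IsRootOf t p r v

lemma LeadsTo.eq_none (h : LeadsTo t p v n r) : p r = none := by
  induction h with
  | root h => exact h
  | step _ _ ih => exact ih

lemma LeadsTo.unique (h : LeadsTo t p v n r) (h' : LeadsTo t p v m r') : n = m ∧ r = r' := by
  induction h generalizing m with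
  | root h =>
    cases h' with
    | root => exact ⟨rfl, rfl⟩
    | step h1 _ => simp [h] at h1
  | step h _ ih =>
    cases h' with
    | root h1 => simp [h] at h1
    | step h1 h2 =>
      obtain rfl := Option.some_injective _ (h.symm.trans h1)
      obtain ⟨rfl, rfl⟩ := ih h2
      exact ⟨rfl, rfl⟩

lemma LeadsTo.of_step {d : D} (h : LeadsTo t p v n r) (hd : p v = some d) :
    ∃ m, n = m + 1 ∧ LeadsTo t p (t v d) m r := by
  cases h with
  | root h1 => simp [hd] at h1
  | step h1 h2 =>
    obtain rfl := Option.some_injective _ (hd.symm.trans h1)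
    exact ⟨_, rfl, h2⟩

lemma IsRootOf.unique (h : IsRootOf t p r v) (h' : IsRootOf t p r' v) : r = r' :=
  (h.choose_spec.unique h'.choose_spec).2

lemma isRootOf_self_iff_eq_none : IsRootOf t p v v ↔ p v = none :=
  ⟨fun ⟨_, h⟩ => h.eq_none, fun h => ⟨0, .root h⟩⟩

lemma isRootOf_iff_of_eq_none (h : p v = none) : IsRootOf t p r v ↔ r = v :=
  ⟨fun h' => h'.unique ⟨0, .root h⟩, by rintro rfl; exact ⟨0, .root h⟩⟩

lemma isRootOf_iff_of_eq_some {d : D} (h : p v = some d) :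
    IsRootOf t p r v ↔ IsRootOf t p r (t v d) :=
  ⟨fun ⟨_, h'⟩ => let ⟨m, _, hm⟩ := h'.of_step h; ⟨m, hm⟩, fun ⟨n, h'⟩ => ⟨n + 1, .step h h'⟩⟩

variable [DecidableEq V] {j : V} {x : Option D}

/-- A vertex closer to its root than `j` does not notice a change of `p` at `j`. -/
lemma LeadsTo.update_of_lt (h : LeadsTo t p v n r) (hj : LeadsTo t p j m r') (hnm : n < m) :
    LeadsTo t (Function.update p j x) v n r := by
  induction h with
  | @root v h =>
    have : v ≠ j := by
      rintro rfl
      have := (hj.unique (.root h)).1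
      omega
    exact .root (by rwa [Function.update_of_ne this])
  | @step v d n r h h2 ih =>
    have : v ≠ j := by
      rintro rfl
      have := (hj.unique (.step h h2)).1
      omega
    exact .step (by rwa [Function.update_of_ne this]) (ih (by omega))

/-- After a change of `p` at `j`, the path from `v` to its root is intact, unless it passes through
`j`, in which case `j` has the same root. -/
lemma LeadsTo.update_or (h : LeadsTo t p v n r) :
    LeadsTo t (Function.update p j x) v n r ∨ IsRootOf t p r j := by
  induction h with
  | @root v h =>
    by_cases hv : v = j
    · exact .inr (hv ▸ ⟨0, .root h⟩)
    · exact .inl (.root (by rwa [Function.update_of_ne hv]))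
  | @step v d n r h h2 ih =>
    by_cases hv : v = j
    · exact .inr (hv ▸ ⟨_, .step h h2⟩)
    · exact ih.imp_left fun h' => .step (by rwa [Function.update_of_ne hv]) h'

/-- If `p` is acyclic and `j` still reaches a root after a change of `p` at `j`, then the changed
parent function is acyclic. -/
lemma Acyclic.update (hp : Acyclic t p) (hj : IsRootOf t (Function.update p j x) r j) :
    Acyclic t (Function.update p j x) := by
  intro v
  obtain ⟨r', n, h⟩ := hp v
  induction h with
  | @root v h =>
    by_cases hv : v = j
    · exact ⟨_, by rw [hv]; exact hj⟩
    · exact ⟨v, 0, .root (by rwa [Function.update_of_ne hv])⟩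
  | @step v d n r h h2 ih =>
    by_cases hv : v = j
    · exact ⟨_, by rw [hv]; exact hj⟩
    · obtain ⟨r'', k, hk⟩ := ih
      exact ⟨r'', k + 1, .step (by rwa [Function.update_of_ne hv]) hk⟩

lemma Acyclic.update_none (hp : Acyclic t p) : Acyclic t (Function.update p j none) :=
  hp.update ⟨0, .root (Function.update_self ..)⟩

/-- The head of the arc that leaves `j` keeps its root when `p` is changed at `j`. -/
lemma Acyclic.isRootOf_update_iff {d : D} (hp : Acyclic t p) (hd : p j = some d) :
    IsRootOf t (Function.update p j x) r (t j d) ↔ IsRootOf t p r j := by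
  obtain ⟨r', n, h⟩ := hp j
  obtain ⟨m, rfl, hm⟩ := h.of_step hd
  have hq : IsRootOf t (Function.update p j x) r' (t j d) := ⟨m, hm.update_of_lt h (by omega)⟩
  have hr : IsRootOf t p r' j := ⟨_, h⟩
  exact ⟨fun h' => h'.unique hq ▸ hr, fun h' => h'.unique hr ▸ hq⟩

/-- If giving `j` the new arc `d` closes a cycle, then the head of `d` has the same root as `j`. -/
lemma Acyclic.isRootOf_iff_of_not_acyclic {d : D} (hp : Acyclic t p)
    (hq : ¬ Acyclic t (Function.update p j (some d))) :
    IsRootOf t p r (t j d) ↔ IsRootOf t p r j := by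
  obtain ⟨r', n, h⟩ := hp (t j d)
  have hr : IsRootOf t p r' j := by
    refine (h.update_or (j := j) (x := some d)).resolve_left fun h' => hq (hp.update (r := r') ?_)
    exact ⟨n + 1, .step (Function.update_self ..) h'⟩
  exact ⟨fun h' => h'.unique ⟨n, h⟩ ▸ hr, fun h' => h'.unique hr ▸ ⟨n, h⟩⟩

/-! ### The linear system for the weights of acyclic parent functions -/

/-- The condition on a pair `(p, x)` that the arc `x` out of `j` leads, by `p`, to the root `i`;
the empty arc `none` ends at `j` itself. -/
def ArcLeadsTo (t : V → D → V) (i j : V) (p : V → Option D) (x : Option D) : Prop :=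
  x.elim (i = j) fun d => IsRootOf t p i (t j d)

open Classical in
/-- The map on pairs `(p, x)` that exchanges the arc of `p` at `j` with `x`, unless this closes a
cycle. -/
noncomputable def exchange (t : V → D → V) (j : V) (z : (V → Option D) × Option D) :
    (V → Option D) × Option D :=
  if Acyclic t (Function.update z.1 j z.2) then (Function.update z.1 j z.2, z.1 j) else z

lemma exchange_exchange (z : (V → Option D) × Option D) (hz : Acyclic t z.1) :
    Acyclic t (exchange t j z).1 ∧ exchange t j (exchange t j z) = z := by
  obtain ⟨p, x⟩ := z
  by_cases h : Acyclic t (Function.update p j x)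
  · have h2 : exchange t j (p, x) = (Function.update p j x, p j) := if_pos h
    rw [h2]
    refine ⟨h, ?_⟩
    have h3 : Function.update (Function.update p j x) j (p j) = p := by simp
    unfold exchange
    rw [if_pos (by simpa only [h3] using hz)]
    simp
  · have h2 : exchange t j (p, x) = (p, x) := if_neg h
    rw [h2]
    exact ⟨hz, h2⟩

lemma arcLeadsTo_exchange_iff {i : V} (z : (V → Option D) × Option D) (hz : Acyclic t z.1) :
    ArcLeadsTo t i j (exchange t j z).1 (exchange t j z).2 ↔ IsRootOf t z.1 i j := by
  obtain ⟨p, x⟩ := z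
  by_cases h : Acyclic t (Function.update p j x)
  · have h2 : exchange t j (p, x) = (Function.update p j x, p j) := if_pos h
    rw [h2]
    change ArcLeadsTo t i j (Function.update p j x) (p j) ↔ IsRootOf t p i j
    cases hd : p j with
    | none => exact (isRootOf_iff_of_eq_none hd).symm
    | some d => exact hz.isRootOf_update_iff hd
  · have h2 : exchange t j (p, x) = (p, x) := if_neg h
    rw [h2]
    cases x with
    | none => exact absurd hz.update_none h
    | some d => exact hz.isRootOf_iff_of_not_acyclic h

variable [Fintype V] {R : Type*} [CommSemiring R]

/-- The weight of a parent function: the product of the weights `b` of its arcs. -/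
def parentWeight (b : Option D → R) (p : V → Option D) : R :=
  ∏ v, b (p v)

lemma parentWeight_exchange (b : Option D → R) (z : (V → Option D) × Option D) :
    parentWeight b (exchange t j z).1 * b (exchange t j z).2 = parentWeight b z.1 * b z.2 := by
  unfold exchange
  split_ifs with h
  · simp only [parentWeight]
    rw [← Finset.mul_prod_erase _ _ (Finset.mem_univ j),
      ← Finset.mul_prod_erase Finset.univ (fun v => b (z.1 v)) (Finset.mem_univ j),
      Finset.prod_congr rfl fun v hv => by
        rw [Function.update_of_ne (Finset.ne_of_mem_erase hv)]]
    rw [Function.update_self]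
    ring
  · rfl

variable [Fintype D]

open Classical in
/-- The total weight of the acyclic parent functions with the property `P`. -/
noncomputable def acyclicSum (t : V → D → V) (b : Option D → R) (P : (V → Option D) → Prop) : R :=
  ∑ p with Acyclic t p ∧ P p, parentWeight b p

/-- The exchange of arcs at `j` yields one linear equation for the weights of the acyclic parent
functions with root `i` at the various vertices. -/
theorem acyclicSum_isRootOf_mul_sum (b : Option D → R) (i j : V) :
    acyclicSum t b (IsRootOf t · i j) * ∑ x, b x =
      ∑ x : Option D, acyclicSum t b (ArcLeadsTo t i j · x) * b x := by
  classical
  have hl : acyclicSum t b (IsRootOf t · i j) * ∑ x, b x =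
      ∑ z : (V → Option D) × Option D with Acyclic t z.1 ∧ IsRootOf t z.1 i j,
        parentWeight b z.1 * b z.2 := by
    rw [acyclicSum, Finset.sum_mul_sum, Finset.sum_filter, Finset.sum_filter,
      Fintype.sum_prod_type]
    refine Finset.sum_congr rfl fun p _ => ?_
    split_ifs <;> simp
  have hr : ∑ x : Option D, acyclicSum t b (ArcLeadsTo t i j · x) * b x =
      ∑ z : (V → Option D) × Option D with Acyclic t z.1 ∧ ArcLeadsTo t i j z.1 z.2,
        parentWeight b z.1 * b z.2 := by
    rw [Finset.sum_filter, Fintype.sum_prod_type_right]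
    refine Finset.sum_congr rfl fun x _ => ?_
    rw [acyclicSum, Finset.sum_mul, Finset.sum_filter]
  rw [hl, hr]
  refine Finset.sum_nbij' (exchange t j) (exchange t j) ?_ ?_ ?_ ?_ ?_
  · simp only [Finset.mem_filter, Finset.mem_univ, true_and]
    exact fun z hz => ⟨(exchange_exchange z hz.1).1, (arcLeadsTo_exchange_iff z hz.1).2 hz.2⟩
  · simp only [Finset.mem_filter, Finset.mem_univ, true_and]
    intro z hz
    have h := exchange_exchange (j := j) z hz.1
    exact ⟨h.1, (arcLeadsTo_exchange_iff _ h.1).1 (by rw [h.2]; exact hz.2)⟩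
  · simp only [Finset.mem_filter, Finset.mem_univ, true_and]
    exact fun z hz => (exchange_exchange z hz.1).2
  · simp only [Finset.mem_filter, Finset.mem_univ, true_and]
    exact fun z hz => (exchange_exchange z hz.1).2
  · exact fun z _ => (parentWeight_exchange b z).symm

end ParentFunction

/-! ### Cycles and reachability in multigraphs -/

section Graph

variable {V E : Type*} {G H H' : Graph V E} {x y z : V} {e : E}

lemma Reachable.symm (h : Reachable G x y) : Reachable G y x := by
  induction h with
  | refl => exact .refl
  | tail _ h ih => exact .head h.symm ih

lemma Reachable.mono (hle : H ≤ G) (h : Reachable H x y) : Reachable G x y :=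
  Relation.ReflTransGen.mono (fun _ _ h => Graph.Adj.mono hle h) _ _ h

/-- An edge outside a subgraph whose ends are joined by a path of that subgraph closes a cycle. -/
lemma hasCycle_of_reachable (hle : H' ≤ H) (hxy : Reachable H' x y) (he : H.IsLink e x y)
    (he' : e ∉ H'.edgeSet) : HasCycle H := by
  let S : SimpleGraph V := SimpleGraph.fromRel H'.Adj
  have hS : S.Reachable x y := by
    clear he
    induction hxy with
    | refl => exact .refl _
    | @tail b c _ h ih =>
      by_cases hbc : b = c
      · exact hbc ▸ ih
      · exact ih.trans (SimpleGraph.Adj.reachable (by simp [S, hbc, h]))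
  obtain ⟨P, hP⟩ := hS.exists_isPath
  have hlink : ∀ i, i < P.length → H'.Adj (P.getVert i) (P.getVert (i + 1)) := fun i hi => by
    have h : S.Adj _ _ := P.adj_getVert_succ hi
    simp only [S, SimpleGraph.fromRel_adj] at h
    exact h.2.elim id fun h' => h'.symm
  choose f hf using hlink
  have hinj := hP.getVert_injOn
  refine ⟨P.length, fun i => P.getVert i, fun i => if h : i.1 < P.length then f i h else e,
    fun i j hij => Fin.ext (hinj (Nat.lt_succ_iff.1 i.2) (Nat.lt_succ_iff.1 j.2) hij), ?_, ?_⟩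
  · intro i j hij
    by_cases hi : i.1 < P.length <;> by_cases hj : j.1 < P.length <;>
      simp only [hi, hj, dif_pos, dif_neg, not_false_eq_true] at hij
    · have h := hf i hi
      rw [hij] at h
      -- Equal edges join the same pair of vertices, in the same order or reversed.
      obtain ⟨h1, -⟩ | ⟨h1, h2⟩ := h.eq_and_eq_or_eq_and_eq (hf j hj)
      · exact Fin.ext (hinj hi.le hj.le h1)
      · have e1 : i.1 = j.1 + 1 := hinj hi.le hj h1
        have e2 : i.1 + 1 = j.1 := hinj hi hj.le h2
        omega
    · exact absurd (hij ▸ (hf i hi).edge_mem) he'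
    · exact absurd (hij ▸ (hf j hj).edge_mem) he'
    · exact Fin.ext (by omega)
  · intro i
    by_cases hi : i.1 < P.length
    · have h1 : (i + 1).1 = i.1 + 1 := Fin.val_add_one_of_lt' (by omega)
      simp only [hi, dif_pos, h1]
      exact (hf i hi).mono hle
    · have h0 : i = Fin.last P.length := Fin.ext (by simp only [Fin.val_last]; omega)
      subst h0
      simpa using he.symm

/-! ### The rooted forest of an acyclic parent function -/

open Classical in
/-- The end of the edge `e` other than `v`. If `e` is not incident to `v`, this is `v` itself; an
arc out of `v` with this label is then a loop, so that no acyclic parent function uses it. -/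
noncomputable def otherEnd (G : Graph V E) (v : V) (e : G.edgeSet) : V :=
  if h : G.Inc e v then h.other else v

lemma otherEnd_eq {e : G.edgeSet} (h : G.IsLink e x y) : otherEnd G x e = y := by
  rw [otherEnd, dif_pos h.inc_left]
  exact h.inc_left.isLink_other.right_unique h

lemma isLink_otherEnd {e : G.edgeSet} (h : otherEnd G x e ≠ x) : G.IsLink e x (otherEnd G x e) := by
  by_cases h' : G.Inc e x
  · rw [otherEnd, dif_pos h']
    exact h'.isLink_other
  · exact absurd (dif_neg h') h

variable {p q : V → Option G.edgeSet} {d : G.edgeSet} {r : V}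

/-- The distance to the root strictly decreases along the arcs of an acyclic parent function. -/
lemma Acyclic.exists_depth {D : Type*} {t : V → D → V} {p : V → Option D} (hp : Acyclic t p) :
    ∃ δ : V → ℕ, ∀ v d, p v = some d → δ v = δ (t v d) + 1 := by
  choose ρ δ h using hp
  refine ⟨δ, fun v d hd => ?_⟩
  obtain ⟨m, hm, hm'⟩ := (h v).of_step hd
  rw [hm, (hm'.unique (h (t v d))).1]

lemma Acyclic.isLink (hp : Acyclic (otherEnd G) p) (hd : p x = some d) :
    G.IsLink d x (otherEnd G x d) := by
  refine isLink_otherEnd fun h => ?_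
  obtain ⟨δ, hδ⟩ := hp.exists_depth
  have := hδ x d hd
  rw [h] at this
  omega

lemma Acyclic.eq_of_eq_some (hp : Acyclic (otherEnd G) p) (hx : p x = some d)
    (hy : p y = some d) : x = y := by
  obtain ⟨δ, hδ⟩ := hp.exists_depth
  obtain ⟨h, -⟩ | ⟨h1, h2⟩ := (hp.isLink hx).eq_and_eq_or_eq_and_eq (hp.isLink hy)
  · exact h
  · have h3 := hδ x d hx
    have h4 := hδ y d hy
    rw [h2] at h3
    rw [← h1] at h4
    omega

/-- The rooted subgraph of a parent function: its edges are the labels of the arcs, its roots are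
the vertices without an arc. -/
def parentForest (G : Graph V E) (p : V → Option G.edgeSet) : Graph V E × Set V :=
  (G.restrict {e | ∃ v d, p v = some d ∧ (d : E) = e}, {v | p v = none})

lemma mem_edgeSet_parentForest :
    e ∈ (parentForest G p).1.edgeSet ↔ ∃ v d, p v = some d ∧ (d : E) = e := by
  simp only [parentForest, Graph.edgeSet_restrict, Set.mem_inter_iff, Set.mem_ofPred_eq,
    and_iff_right_iff_imp]
  rintro ⟨_, d, _, rfl⟩
  exact d.2

lemma mem_roots_parentForest : x ∈ (parentForest G p).2 ↔ p x = none := Iff.rfl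

lemma parentForest_le : (parentForest G p).1 ≤ G := Graph.restrict_le

lemma Acyclic.isLink_parentForest (hp : Acyclic (otherEnd G) p) (hd : p x = some d) :
    (parentForest G p).1.IsLink d x (otherEnd G x d) :=
  ⟨⟨x, d, hd, rfl⟩, hp.isLink hd⟩

/-- Each edge of the forest is the arc out of one of its ends. -/
lemma Acyclic.exists_arc (hp : Acyclic (otherEnd G) p) (h : (parentForest G p).1.IsLink e x y) :
    ∃ d : G.edgeSet, d = e ∧
      (p x = some d ∧ otherEnd G x d = y ∨ p y = some d ∧ otherEnd G y d = x) := by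
  obtain ⟨⟨v, d, hd, rfl⟩, h⟩ := h
  refine ⟨d, rfl, ?_⟩
  obtain ⟨rfl, h2⟩ | ⟨h1, rfl⟩ := h.eq_and_eq_or_eq_and_eq (hp.isLink hd)
  · exact .inl ⟨hd, h2.symm⟩
  · exact .inr ⟨hd, h1.symm⟩

lemma Acyclic.not_hasCycle (hp : Acyclic (otherEnd G) p) : ¬ HasCycle (parentForest G p).1 := by
  rintro ⟨m, v, e, hv, he, hl⟩
  obtain ⟨δ, hδ⟩ := hp.exists_depth
  -- Both edges of the cycle at a vertex of maximal depth would be the arc out of that vertex.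
  obtain ⟨i, hi⟩ := Finite.exists_max (fun i => δ (v i))
  have key : ∀ k l, (parentForest G p).1.IsLink (e k) (v i) (v l) →
      ∃ d : G.edgeSet, d = e k ∧ p (v i) = some d ∧ otherEnd G (v i) d = v l := by
    intro k l h
    obtain ⟨d, hd, h1 | ⟨h1, h2⟩⟩ := hp.exists_arc h
    · exact ⟨d, hd, h1⟩
    · have h3 := hδ _ _ h1
      have h4 := hi l
      rw [h2] at h3
      omega
  obtain ⟨d, hd, h1, h2⟩ := key i (i + 1) (hl i)
  obtain ⟨d', hd', h1', -⟩ := key (i - 1) (i - 1) (by simpa using (hl (i - 1)).symm)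
  obtain rfl := Option.some_injective _ (h1.symm.trans h1')
  have hii : i = i - 1 := he (hd.symm.trans hd')
  have hii' : i + 1 = i := by
    conv_rhs => rw [← sub_add_cancel i 1, ← hii]
  have h3 := hδ _ _ h1
  rw [h2, hii'] at h3
  omega

lemma Acyclic.isRootOf_iff_of_adj (hp : Acyclic (otherEnd G) p)
    (h : (parentForest G p).1.Adj x y) :
    IsRootOf (otherEnd G) p r x ↔ IsRootOf (otherEnd G) p r y := by
  obtain ⟨e, he⟩ := h
  obtain ⟨d, -, ⟨h1, h2⟩ | ⟨h1, h2⟩⟩ := hp.exists_arc he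
  · rw [isRootOf_iff_of_eq_some h1, h2]
  · rw [isRootOf_iff_of_eq_some (v := y) h1, h2]

lemma Acyclic.isRootOf_iff_of_reachable (hp : Acyclic (otherEnd G) p)
    (h : Reachable (parentForest G p).1 x y) :
    IsRootOf (otherEnd G) p r x ↔ IsRootOf (otherEnd G) p r y := by
  induction h with
  | refl => rfl
  | tail _ h ih => rw [ih, hp.isRootOf_iff_of_adj h]

lemma Acyclic.reachable_of_isRootOf (hp : Acyclic (otherEnd G) p)
    (h : IsRootOf (otherEnd G) p r x) : Reachable (parentForest G p).1 x r := by
  obtain ⟨n, h⟩ := h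
  induction h with
  | root => exact .refl
  | step h _ ih => exact .head ⟨_, hp.isLink_parentForest h⟩ ih

/-- The root that a vertex reaches along the arcs is the root of its tree in the forest. -/
lemma Acyclic.isRootOf_iff (hp : Acyclic (otherEnd G) p) :
    IsRootOf (otherEnd G) p r x ↔
      r ∈ (parentForest G p).2 ∧ Reachable (parentForest G p).1 r x := by
  constructor
  · exact fun h => ⟨h.choose_spec.eq_none, (hp.reachable_of_isRootOf h).symm⟩
  · exact fun ⟨h1, h2⟩ => (hp.isRootOf_iff_of_reachable h2).1 (isRootOf_self_iff_eq_none.2 h1)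

lemma Acyclic.isSpanningRootedForest (hV : G.vertexSet = Set.univ)
    (hp : Acyclic (otherEnd G) p) : IsSpanningRootedForest G (parentForest G p) where
  spanning := ⟨parentForest_le, rfl⟩
  acyclic := hp.not_hasCycle
  roots_subset _ _ := by simp [parentForest, hV]
  existsUnique_root := by
    rintro _ ⟨x, -, rfl⟩
    obtain ⟨r, hr⟩ := hp x
    refine ⟨r, ⟨(hp.isRootOf_iff.1 hr).1, (hp.isRootOf_iff.1 hr).2.symm⟩, ?_⟩
    exact fun r' hr' => (hp.isRootOf_iff.2 ⟨hr'.1, hr'.2.symm⟩).unique hr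

/-- An acyclic parent function is determined by its rooted forest: by induction on the distance to
the root, the arc at each vertex is. -/
lemma LeadsTo.eq_of_parentForest_eq {n : ℕ} (hp : Acyclic (otherEnd G) p)
    (hq : Acyclic (otherEnd G) q) (hpq : parentForest G p = parentForest G q)
    (h : LeadsTo (otherEnd G) p x n r) : p x = q x := by
  induction h with
  | @root v h =>
    have : v ∈ (parentForest G q).2 := hpq ▸ h
    rw [h, mem_roots_parentForest.1 this]
  | @step v d n r h _ ih =>
    have hl := hp.isLink_parentForest h
    rw [hpq] at hl
    obtain ⟨d', hd, ⟨h1, -⟩ | ⟨h1, -⟩⟩ := hq.exists_arc hl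
    · rw [h, h1, Subtype.ext hd]
    · -- The arc `d` cannot be reversed in `q`: the next arc is the same in `p` and `q`.
      rw [Subtype.ext hd] at h1
      have h2 := hp.eq_of_eq_some h (ih.trans h1)
      rw [h2, ih]

lemma parentForest_injOn : Set.InjOn (parentForest G) {p | Acyclic (otherEnd G) p} := by
  intro p hp q hq hpq
  funext x
  obtain ⟨r, n, h⟩ := hp x
  exact h.eq_of_parentForest_eq hp hq hpq

/-! ### Every rooted forest has a parent function -/

/-- `IsNear H R n x`: there is a walk of length `n` in `H` from `x` to the set `R`. -/
inductive IsNear (H : Graph V E) (R : Set V) : ℕ → V → Prop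
  | zero {x : V} : x ∈ R → IsNear H R 0 x
  | succ {x y : V} {n : ℕ} : H.Adj x y → IsNear H R n y → IsNear H R (n + 1) x

lemma exists_isNear {R : Set V} (hr : r ∈ R) (h : Reachable H x r) : ∃ n, IsNear H R n x := by
  induction h using Relation.ReflTransGen.head_induction_on with
  | refl => exact ⟨0, .zero hr⟩
  | head h _ ih => exact ⟨_, .succ h ih.choose_spec⟩

/-- Sending each vertex along the first edge of a shortest path to a root gives an acyclic parent
function; in an acyclic graph it uses all edges. -/
lemma IsSpanningRootedForest.exists_parentForest_eq (hV : G.vertexSet = Set.univ)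
    {F : Graph V E × Set V} (hF : IsSpanningRootedForest G F) :
    ∃ p, Acyclic (otherEnd G) p ∧ parentForest G p = F := by
  classical
  obtain ⟨H, R⟩ := F
  obtain ⟨hs, hc, -, hR⟩ := hF
  dsimp only at hs hc hR
  have hHV : H.vertexSet = Set.univ := hs.vertexSet_eq.trans hV
  have hR' : ∀ x, ∃! r, r ∈ R ∧ Reachable H x r := fun x =>
    hR {y | Reachable H x y} ⟨x, by simp [hHV], rfl⟩
  have hnear : ∀ x, ∃ n, IsNear H R n x := fun x =>
    let ⟨_, hr, _⟩ := hR' x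
    exists_isNear hr.1 hr.2
  let δ : V → ℕ := fun x => Nat.find (hnear x)
  have hδ : ∀ x, x ∉ R → ∃ (e : G.edgeSet) (y : V), H.IsLink e x y ∧ δ y < δ x := by
    intro x hx
    have h : IsNear H R (δ x) x := Nat.find_spec (hnear x)
    generalize hn : δ x = n at h
    cases h with
    | zero h => exact absurd h hx
    | @succ _ y n h h' =>
      obtain ⟨e, he⟩ := h
      refine ⟨⟨e, (he.mono hs.le).edge_mem⟩, y, he, ?_⟩
      exact Nat.lt_succ_of_le (Nat.find_min' (hnear y) h')
  choose e y hl hlt using hδ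
  let p : V → Option G.edgeSet := fun x => if h : x ∈ R then none else some (e x h)
  have hpn : ∀ x, p x = none ↔ x ∈ R := fun x => by simp [p]
  have hps : ∀ x (h : x ∉ R), p x = some (e x h) := fun x h => dif_neg h
  have hp : Acyclic (otherEnd G) p := by
    intro x
    induction hk : δ x using Nat.strong_induction_on generalizing x with
    | _ k ih =>
      by_cases hx : x ∈ R
      · exact ⟨x, 0, .root ((hpn x).2 hx)⟩
      · have ho : otherEnd G x (e x hx) = y x hx := otherEnd_eq ((hl x hx).mono hs.le)
        obtain ⟨r, n, h⟩ := ih _ (hk ▸ hlt x hx) _ rfl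
        exact ⟨r, n + 1, .step (hps x hx) (ho.symm ▸ h)⟩
  have hroots : (parentForest G p).2 = R := Set.ext hpn
  have hle : (parentForest G p).1 ≤ H := by
    refine (Graph.Compatible.of_le_le parentForest_le hs.le).le_iff.2 ⟨by simp [hHV], ?_⟩
    intro a ha
    obtain ⟨x, d, hd, rfl⟩ := mem_edgeSet_parentForest.1 ha
    have hx : x ∉ R := fun h => by simp [(hpn x).2 h] at hd
    obtain rfl := Option.some_injective _ ((hps x hx).symm.trans hd)
    exact (hl x hx).edge_mem
  have hedge : (parentForest G p).1.edgeSet = H.edgeSet := by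
    refine (Graph.IsSubgraph.edgeSet_mono hle).antisymm fun a ha => ?_
    by_contra hn
    obtain ⟨u, w, huw⟩ := Graph.exists_isLink_of_mem_edgeSet ha
    obtain ⟨r, hr⟩ := hp u
    obtain ⟨r', hr'⟩ := hp w
    have h1 := hp.isRootOf_iff.1 hr
    have h2 := hp.isRootOf_iff.1 hr'
    rw [hroots] at h1 h2
    obtain rfl : r = r' := (hR' u).unique ⟨h1.1, h1.2.symm.mono hle⟩
      ⟨h2.1, .head ⟨a, huw⟩ (h2.2.symm.mono hle)⟩
    exact hc (hasCycle_of_reachable hle (h1.2.symm.trans h2.2) huw hn)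
  have hsub : (parentForest G p).1.IsSpanningSubgraph H :=
    ⟨hle, by rw [hHV, ← hV]; rfl⟩
  exact ⟨p, hp, Prod.ext (hsub.ext_of_edgeSet hedge) hroots⟩

end Graph

/-! ### The Laplacian matrix -/

section Laplacian

variable {V E : Type*} {G : Graph V E}

lemma totalWeight_comm (ε : E → ℝ) (i j : V) : totalWeight G ε i j = totalWeight G ε j i := by
  simp only [totalWeight, Graph.isLink_comm (x := i)]

variable [DecidableEq V]

lemma totalWeight_eq_sum [Fintype G.edgeSet] (ε : E → ℝ) {j k : V} (hjk : j ≠ k) :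
    totalWeight G ε j k = ∑ e : G.edgeSet, if otherEnd G j e = k then ε e else 0 := by
  have hset : {e | G.IsLink e j k} = Subtype.val ''
      (({e | otherEnd G j e = k} : Finset G.edgeSet) : Set G.edgeSet) := by
    ext e
    simp only [Finset.coe_filter, Finset.mem_univ, true_and]
    constructor
    · exact fun h => ⟨⟨e, Graph.IsLink.edge_mem h⟩, otherEnd_eq h, rfl⟩
    · rintro ⟨d, rfl, rfl⟩
      exact isLink_otherEnd hjk.symm
  rw [totalWeight, hset, finsum_mem_image Subtype.val_injective.injOn, finsum_mem_coe_finset,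
    Finset.sum_filter]

variable [Fintype V]

lemma laplacian_transpose (ε : E → ℝ) : (laplacian G ε).transpose = laplacian G ε := by
  ext i j
  simp only [laplacian, Matrix.transpose_apply, Matrix.of_apply]
  by_cases h : i = j
  · rw [h]
  · rw [if_neg h, if_neg (Ne.symm h), totalWeight_comm]

/-- The Laplacian as an operator: the differences along the edges at `j`. -/
lemma sum_laplacian_mul [Fintype G.edgeSet] (ε : E → ℝ) (j : V) (f : V → ℝ) :
    ∑ k, laplacian G ε j k * f k = ∑ e : G.edgeSet, ε e * (f j - f (otherEnd G j e)) := by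
  have h1 : ∑ k, laplacian G ε j k * f k =
      ∑ k ∈ Finset.univ.erase j, totalWeight G ε j k * (f j - f k) := by
    rw [← Finset.add_sum_erase _ _ (Finset.mem_univ j)]
    have h2 : ∑ k ∈ Finset.univ.erase j, laplacian G ε j k * f k =
        ∑ k ∈ Finset.univ.erase j, -(totalWeight G ε j k * f k) :=
      Finset.sum_congr rfl fun k hk => by
        simp [laplacian, (Finset.ne_of_mem_erase hk).symm]
    rw [h2]
    simp only [laplacian, Matrix.of_apply, if_true, Finset.sum_mul, ← Finset.sum_add_distrib]
    exact Finset.sum_congr rfl fun k _ => by ring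
  have h3 : ∀ k ∈ Finset.univ.erase j, totalWeight G ε j k * (f j - f k) =
      ∑ e : G.edgeSet, if otherEnd G j e = k then ε e * (f j - f k) else 0 := fun k hk => by
    rw [totalWeight_eq_sum ε (Finset.ne_of_mem_erase hk).symm, Finset.sum_mul]
    simp only [ite_mul, zero_mul]
  rw [h1, Finset.sum_congr rfl h3, Finset.sum_erase _ (by
    refine Finset.sum_eq_zero fun e _ => ?_
    simp), Finset.sum_comm]
  simp

end Laplacian

/-! ### Weights of sets of rooted forests -/

section Weights

variable {V E : Type*} {G : Graph V E} {p : V → Option G.edgeSet}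

/-- The weight of an arc of a parent function: `τ * ε e` for the label `e`, and `1` for the empty
arc at a root. -/
noncomputable def arcWeight (G : Graph V E) (ε : E → ℝ) (τ : ℝ) (x : Option G.edgeSet) : ℝ :=
  x.elim 1 fun e => τ * ε e

/-- The edge of the arc at a vertex that is not a root. -/
def arcEdge (p : V → Option G.edgeSet) (v : {v // (p v).isSome}) : E :=
  ((p v).get v.2 : G.edgeSet)

lemma edgeSet_parentForest : (parentForest G p).1.edgeSet = Set.range (arcEdge p) := by
  ext e
  rw [mem_edgeSet_parentForest]
  constructor
  · rintro ⟨v, d, hd, rfl⟩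
    exact ⟨⟨v, by simp [hd]⟩, by simp [arcEdge, hd]⟩
  · rintro ⟨v, rfl⟩
    exact ⟨v, (p v).get v.2, by simp, rfl⟩

lemma Acyclic.arcEdge_injective (hp : Acyclic (otherEnd G) p) :
    Function.Injective (arcEdge p) := by
  intro v w h
  refine Subtype.ext (hp.eq_of_eq_some (d := (p v).get v.2) (by simp) ?_)
  rw [Subtype.ext h]
  simp

variable [Fintype V]

lemma Acyclic.ncard_edgeSet (hp : Acyclic (otherEnd G) p) :
    (parentForest G p).1.edgeSet.ncard = Fintype.card {v // (p v).isSome} := by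
  rw [edgeSet_parentForest, ← Set.image_univ, Set.ncard_image_of_injective _ hp.arcEdge_injective,
    Set.ncard_univ, Nat.card_eq_fintype_card]

lemma Acyclic.pow_mul_subgraphWeight (hp : Acyclic (otherEnd G) p) (ε : E → ℝ) (τ : ℝ) :
    τ ^ (parentForest G p).1.edgeSet.ncard * subgraphWeight ε (parentForest G p).1 =
      parentWeight (arcWeight G ε τ) p := by
  have h1 : subgraphWeight ε (parentForest G p).1 =
      ∏ v : {v // (p v).isSome}, ε (arcEdge p v) := by
    rw [subgraphWeight, edgeSet_parentForest, finprod_mem_range hp.arcEdge_injective,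
      finprod_eq_prod_of_fintype]
  rw [h1, hp.ncard_edgeSet, ← Finset.card_univ, ← Finset.prod_const, ← Finset.prod_mul_distrib,
    parentWeight, ← Finset.prod_subset (Finset.subset_univ {v | (p v).isSome})]
  · rw [Finset.prod_subtype (p := fun v => (p v).isSome) _ (by simp)]
    refine Finset.prod_congr rfl fun v _ => ?_
    have hv : p v = some ((p v).get v.2) := by simp
    rw [hv]
    rfl
  · intro v _ hv
    have : p v = none := by simpa using hv
    simp [this, arcWeight]

/-- Every component of `G` contains a root. -/
lemma Acyclic.ncard_edgeSet_le (hp : Acyclic (otherEnd G) p) :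
    (parentForest G p).1.edgeSet.ncard ≤ Fintype.card V - numComponents G := by
  classical
  have h1 : numComponents G ≤ Fintype.card {v // ¬ (p v).isSome} := by
    have hsub : components G ⊆
        (fun r => {y | Reachable G r y}) '' ({v | ¬ (p v).isSome} : Set V) := by
      rintro _ ⟨x, -, rfl⟩
      obtain ⟨r, hr⟩ := hp x
      have h2 : Reachable G r x := (hp.isRootOf_iff.1 hr).2.mono parentForest_le
      refine ⟨r, by simp [hr.choose_spec.eq_none], Set.ext fun y => ?_⟩
      exact ⟨fun h => h2.symm.trans h, fun h => h2.trans h⟩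
    refine (Set.ncard_le_ncard hsub (Set.toFinite _)).trans
      ((Set.ncard_image_le (Set.toFinite _)).trans_eq ?_)
    rw [← Nat.card_coe_set_eq, ← Nat.card_eq_fintype_card]
    rfl
  have h2 := Fintype.card_subtype_compl (fun v => (p v).isSome = true)
  have h3 := Fintype.card_subtype_le (fun v => (p v).isSome = true)
  rw [hp.ncard_edgeSet]
  omega

variable [DecidableEq V] [Fintype G.edgeSet]

/-- The generating function of the rooted forests with a property `Q` is a sum over acyclic parent
functions. -/
lemma sum_pow_mul_setWeight (hV : G.vertexSet = Set.univ) (ε : E → ℝ) (τ : ℝ)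
    {Q : Graph V E × Set V → Prop} {P : (V → Option G.edgeSet) → Prop}
    (hPQ : ∀ p, Acyclic (otherEnd G) p → (Q (parentForest G p) ↔ P p)) :
    ∑ k ∈ Finset.range (Fintype.card V - numComponents G + 1),
      τ ^ k * setWeight ε {F | F ∈ forests G k ∧ Q F} =
        acyclicSum (otherEnd G) (arcWeight G ε τ) P := by
  classical
  have himage : ∀ k, {F | F ∈ forests G k ∧ Q F} = parentForest G ''
      (({p | (Acyclic (otherEnd G) p ∧ P p) ∧ (parentForest G p).1.edgeSet.ncard = k} :
        Finset (V → Option G.edgeSet)) : Set (V → Option G.edgeSet)) := by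
    intro k
    ext F
    simp only [Finset.coe_filter, Finset.mem_univ, true_and]
    constructor
    · rintro ⟨⟨hF, hk⟩, hQ⟩
      obtain ⟨p, hp, rfl⟩ := hF.exists_parentForest_eq hV
      exact ⟨p, ⟨⟨hp, (hPQ p hp).1 hQ⟩, hk⟩, rfl⟩
    · rintro ⟨p, ⟨⟨hp, hP⟩, hk⟩, rfl⟩
      exact ⟨⟨hp.isSpanningRootedForest hV, hk⟩, (hPQ p hp).2 hP⟩
  have hweight : ∀ k, setWeight ε {F | F ∈ forests G k ∧ Q F} =
      ∑ p : V → Option G.edgeSet with Acyclic (otherEnd G) p ∧ P p,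
        if (parentForest G p).1.edgeSet.ncard = k then
          subgraphWeight ε (parentForest G p).1 else 0 := by
    intro k
    rw [setWeight, himage, finsum_mem_image, finsum_mem_coe_finset, ← Finset.filter_filter,
      Finset.sum_filter]
    refine parentForest_injOn.mono fun p hp => ?_
    simp only [Finset.coe_filter, Finset.mem_univ, true_and] at hp
    exact hp.1.1
  simp_rw [hweight, Finset.mul_sum]
  rw [Finset.sum_comm, acyclicSum]
  refine Finset.sum_congr rfl fun p hp => ?_
  have hp' : Acyclic (otherEnd G) p := (Finset.mem_filter.1 hp).2.1
  simp only [mul_ite, mul_zero]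
  rw [Finset.sum_ite_eq, if_pos (Finset.mem_range_succ_iff.2 hp'.ncard_edgeSet_le),
    hp'.pow_mul_subgraphWeight]

lemma acyclicSum_pos {ε : E → ℝ} (hε : ∀ e ∈ G.edgeSet, 0 < ε e) {τ : ℝ} (hτ : 0 ≤ τ) :
    0 < acyclicSum (otherEnd G) (arcWeight G ε τ) fun _ => True := by
  classical
  have hb : ∀ x : Option G.edgeSet, 0 ≤ arcWeight G ε τ x := by
    rintro (_ | e)
    · exact zero_le_one
    · exact mul_nonneg hτ (hε e e.2).le
  refine Finset.sum_pos' (fun p _ => Finset.prod_nonneg fun v _ => hb _) ?_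
  -- The parent function without arcs has weight `1`.
  refine ⟨fun _ => none, ?_, by simp [parentWeight, arcWeight]⟩
  simp only [Finset.mem_filter, Finset.mem_univ, and_true, true_and]
  exact fun v => ⟨v, 0, .root rfl⟩

/-- The linear system for the weights of the parent functions in which `j` leads to `i`, in matrix
form; note that the row index is the vertex `j` and the column index is the root `i`. -/
lemma one_add_smul_laplacian_mul (ε : E → ℝ) (τ : ℝ) :
    (1 + τ • laplacian G ε) * Matrix.of (fun j i =>
      acyclicSum (otherEnd G) (arcWeight G ε τ) (IsRootOf (otherEnd G) · i j)) =
        acyclicSum (otherEnd G) (arcWeight G ε τ) (fun _ => True) • (1 : Matrix V V ℝ) := by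
  ext j i
  have h := acyclicSum_isRootOf_mul_sum (t := otherEnd G) (arcWeight G ε τ) i j
  rw [Fintype.sum_option, Fintype.sum_option] at h
  have h0 : acyclicSum (otherEnd G) (arcWeight G ε τ) (ArcLeadsTo (otherEnd G) i j · none) =
      if i = j then acyclicSum (otherEnd G) (arcWeight G ε τ) (fun _ => True) else 0 := by
    change acyclicSum _ _ (fun _ => i = j) = _
    by_cases hij : i = j
    · rw [if_pos hij, eq_true hij]
    · rw [if_neg hij, eq_false hij]
      simp [acyclicSum]
  rw [h0] at h
  simp only [arcWeight, Option.elim, ArcLeadsTo, mul_one] at h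
  rw [add_mul, one_mul, Matrix.add_apply, Matrix.smul_mul, Matrix.smul_apply, Matrix.mul_apply,
    Matrix.smul_apply, Matrix.one_apply]
  simp only [Matrix.of_apply]
  rw [sum_laplacian_mul ε j fun k =>
    acyclicSum (otherEnd G) (arcWeight G ε τ) (IsRootOf (otherEnd G) · i k)]
  simp only [smul_eq_mul, mul_ite, mul_one, mul_zero, eq_comm (a := j)]
  rw [Finset.mul_sum, Finset.sum_congr rfl fun e _ => show _ = _ - _ by
    rw [mul_sub, mul_sub, ← mul_assoc, ← mul_assoc], Finset.sum_sub_distrib]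
  rw [mul_add, mul_one, Finset.mul_sum] at h
  simp only [mul_comm (τ * _)]
  linarith

end Weights

end MatrixForest

theorem theorem2 {V E : Type*} [Fintype V] [DecidableEq V] (G : Graph V E)
    (hV : G.vertexSet = Set.univ) (hE : G.edgeSet.Finite)
    (ε : E → ℝ) (hε : ∀ e ∈ G.edgeSet, 0 < ε e) (τ : ℝ) (hτ : 0 ≤ τ) :
    IsUnit (1 + τ • MatrixForest.laplacian G ε) ∧
    ∑ k ∈ Finset.range (Fintype.card V - MatrixForest.numComponents G + 1),
      τ ^ k * MatrixForest.setWeight ε (MatrixForest.forests G k) ≠ 0 ∧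
    ∀ i j : V,
      (1 + τ • MatrixForest.laplacian G ε)⁻¹ i j =
        (∑ k ∈ Finset.range (Fintype.card V - MatrixForest.numComponents G + 1),
          τ ^ k * MatrixForest.setWeight ε (MatrixForest.forestsRootedAt G i j k)) /
        (∑ k ∈ Finset.range (Fintype.card V - MatrixForest.numComponents G + 1),
          τ ^ k * MatrixForest.setWeight ε (MatrixForest.forests G k)) := by
  have : Fintype G.edgeSet := hE.fintype
  have hden := MatrixForest.sum_pow_mul_setWeight hV ε τ (Q := fun _ => True)
    (P := fun _ => True) fun _ _ => Iff.rfl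
  have hnum : ∀ i j, _ := fun i j =>
    MatrixForest.sum_pow_mul_setWeight hV ε τ
      (Q := fun F => i ∈ F.2 ∧ MatrixForest.Reachable F.1 i j)
      (P := (MatrixForest.IsRootOf (MatrixForest.otherEnd G) · i j))
      fun p hp => hp.isRootOf_iff.symm
  simp only [and_true, Set.ofPred_mem_eq] at hden
  have hpos := MatrixForest.acyclicSum_pos (G := G) hε hτ
  have hmul := MatrixForest.one_add_smul_laplacian_mul (G := G) ε τ
  rw [← hden] at hpos hmul
  generalize hZ : ∑ k ∈ Finset.range (Fintype.card V - MatrixForest.numComponents G + 1),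
      τ ^ k * MatrixForest.setWeight ε (MatrixForest.forests G k) = Z at *
  have hinv : (1 + τ • MatrixForest.laplacian G ε) * (Z⁻¹ • Matrix.of fun j i =>
      MatrixForest.acyclicSum (MatrixForest.otherEnd G) (MatrixForest.arcWeight G ε τ)
        (MatrixForest.IsRootOf (MatrixForest.otherEnd G) · i j)) = 1 := by
    rw [Matrix.mul_smul, hmul, smul_smul, inv_mul_cancel₀ hpos.ne', one_smul]
  refine ⟨IsUnit.of_mul_eq_one _ hinv, hpos.ne', fun i j => ?_⟩
  -- The Laplacian is symmetric, hence so is the inverse; this exchanges root and target.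
  have hsymm : (1 + τ • MatrixForest.laplacian G ε)⁻¹ i j =
      (1 + τ • MatrixForest.laplacian G ε)⁻¹ j i := by
    rw [← Matrix.transpose_apply (1 + τ • MatrixForest.laplacian G ε)⁻¹ i j,
      Matrix.transpose_nonsing_inv, Matrix.transpose_add, Matrix.transpose_one,
      Matrix.transpose_smul, MatrixForest.laplacian_transpose]
  rw [hsymm, Matrix.inv_eq_right_inv hinv, Matrix.smul_apply, Matrix.of_apply, smul_eq_mul,
    div_eq_inv_mul]
  exact congrArg _ (hnum i j).symm
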